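/- Let $X$ be a nonzero complex Banach space and let $T$ be a bounded linear operator on $X$. Suppose that $T$ is weakly hypercyclic, that is, there is a vector $x\in X$ whose orbit $\{T^n x : n\ge 0\}$ is dense in $X$ for the weak topology. Then every connected component of the spectrum $\sigma(T)$ meets the unit circle $\{z\in\mathbb{C} : |z|=1\}$. -/

import Mathlib

/-- The orbit `{T ^ n x : n ≥ 0}` of a vector `x` under a bounded operator `T`. -/
def operatorOrbit {X : Type*} [NormedAddCommGroup X] [NormedSpace ℂ X]
    (T : X →L[ℂ] X) (x : X) : Set X :=
  Set.range fun n : ℕ => (T ^ n) x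

/-- `x` is a weakly hypercyclic vector for `T`: its orbit is dense for the weak topology
of `X` (the topology of `WeakSpace ℂ X`). -/
def IsWeaklyHypercyclicVector {X : Type*} [NormedAddCommGroup X] [NormedSpace ℂ X]
    (T : X →L[ℂ] X) (x : X) : Prop :=
  Dense (toWeakSpace ℂ X '' operatorOrbit T x)

/-- `T` is weakly hypercyclic: it has a weakly hypercyclic vector. -/
def IsWeaklyHypercyclic {X : Type*} [NormedAddCommGroup X] [NormedSpace ℂ X]
    (T : X →L[ℂ] X) : Prop :=
  ∃ x : X, IsWeaklyHypercyclicVector T x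

/-! If a component misses the circle, it lies in the open disc or in the exterior. A smooth cutoff
`f` isolates a clopen piece of the spectrum around it, and `P = ∫ ∂̄f(z) (z - T)⁻¹` plays the role
of the Riesz projection without contours. Only three facts are needed: `P` commutes with `T`, `P ≠
0`, and `∂̄f·u` integrates to `0` for `u` holomorphic near the support of `f`, so that right
multiplication by `T` multiplies `u` by `z`. In the disc, `P T ^ n` is bounded, so a nonzero
functional `g ∘ P` is bounded on the orbit, against weak density. In the exterior, `‖T ^ n x‖` grows
geometrically, and finitely many functionals then keep the orbit out of a weak neighbourhood of `0`.
-/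

/-! ### The `∂̄` operator, Stokes and Cauchy-Pompeiu formulas -/

/-- The (unnormalised) Cauchy-Riemann operator `∂f/∂x + i ∂f/∂y`. -/
noncomputable def dbar (f : ℂ → ℂ) (z : ℂ) : ℂ :=
  fderiv ℝ f z 1 + Complex.I * fderiv ℝ f z Complex.I

theorem dbar_mul_of_differentiableAt {f g : ℂ → ℂ} {z : ℂ} (hf : DifferentiableAt ℝ f z)
    (hg : DifferentiableAt ℂ g z) : dbar (fun w => f w * g w) z = dbar f z * g z := by
  have hg' := hg.hasDerivAt.hasFDerivAt.restrictScalars ℝ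
  have h := (hf.hasFDerivAt.mul hg').fderiv
  unfold dbar
  rw [show (fun w => f w * g w) = f * g from rfl, h]
  simp
  linear_combination (f z * deriv g z) * Complex.I_mul_I

theorem Filter.EventuallyEq.dbar_eq {f g : ℂ → ℂ} {z : ℂ} (h : f =ᶠ[nhds z] g) :
    dbar f z = dbar g z := by
  unfold dbar; rw [h.fderiv_eq]

theorem dbar_eq_zero_of_eventuallyEq_const {f : ℂ → ℂ} {z c : ℂ} (h : ∀ᶠ w in nhds z, f w = c) :
    dbar f z = 0 := by
  have : f =ᶠ[nhds z] fun _ => c := h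
  rw [this.dbar_eq]; simp [dbar]

theorem dbar_eq_zero_of_notMem_tsupport {f : ℂ → ℂ} {z : ℂ} (h : z ∉ tsupport f) :
    dbar f z = 0 :=
  dbar_eq_zero_of_eventuallyEq_const (c := 0) (notMem_tsupport_iff_eventuallyEq.1 h)

theorem tsupport_dbar_subset (f : ℂ → ℂ) : tsupport (dbar f) ⊆ tsupport f :=
  closure_minimal (fun _ hz => by_contra fun h => hz (dbar_eq_zero_of_notMem_tsupport h))
    (isClosed_tsupport f)

theorem HasCompactSupport.dbar {f : ℂ → ℂ} (hf : HasCompactSupport f) :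
    HasCompactSupport (dbar f) :=
  hf.of_isClosed_subset (isClosed_tsupport _) (tsupport_dbar_subset f)

theorem ContDiff.continuous_dbar {f : ℂ → ℂ} (hf : ContDiff ℝ 1 f) : Continuous (dbar f) := by
  have := hf.continuous_fderiv one_ne_zero
  unfold dbar
  fun_prop

theorem dbar_sub {f g : ℂ → ℂ} {z : ℂ} (hf : DifferentiableAt ℝ f z)
    (hg : DifferentiableAt ℝ g z) : dbar (fun w => f w - g w) z = dbar f z - dbar g z := by
  unfold dbar
  rw [fderiv_fun_sub hf hg]
  simp; ring

theorem integral_fderiv_apply_eq_zero {f : ℂ → ℂ} (hf : ContDiff ℝ 1 f) (hc : HasCompactSupport f)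
    (v : ℂ) : ∫ z, fderiv ℝ f z v = 0 := by
  have hfi : MeasureTheory.Integrable f := hf.continuous.integrable_of_hasCompactSupport hc
  have hfi' : MeasureTheory.Integrable (fun z => fderiv ℝ f z v) :=
    ((hf.continuous_fderiv one_ne_zero).clm_apply
      continuous_const).integrable_of_hasCompactSupport (hc.fderiv_apply ℝ v)
  have := integral_mul_fderiv_eq_neg_fderiv_mul_of_integrable (μ := MeasureTheory.volume)
    (f := fun _ : ℂ => (1 : ℂ)) (g := f) (v := v)
    (by simp) (by simpa using hfi') (by simpa using hfi)
    (fun x _ => differentiableAt_const _) (fun x _ => hf.differentiable one_ne_zero x)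
  simpa using this

theorem integral_dbar_eq_zero {f : ℂ → ℂ} (hf : ContDiff ℝ 1 f) (hc : HasCompactSupport f) :
    ∫ z, dbar f z = 0 := by
  have hfi (v : ℂ) : MeasureTheory.Integrable (fun z => fderiv ℝ f z v) :=
    ((hf.continuous_fderiv one_ne_zero).clm_apply
      continuous_const).integrable_of_hasCompactSupport (hc.fderiv_apply ℝ v)
  unfold dbar
  rw [MeasureTheory.integral_add (hfi 1) ((hfi _).const_mul _),
    MeasureTheory.integral_const_mul, integral_fderiv_apply_eq_zero hf hc,
    integral_fderiv_apply_eq_zero hf hc]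
  simp

/-- Stokes' formula for a cutoff function and a function holomorphic on its support. -/

theorem integral_dbar_mul_eq_zero {f g : ℂ → ℂ} {U : Set ℂ} (hU : IsOpen U)
    (hf : ContDiff ℝ 1 f) (hc : HasCompactSupport f) (hfU : tsupport f ⊆ U)
    (hg : DifferentiableOn ℂ g U) : ∫ z, dbar f z * g z = 0 := by
  have hfg : ContDiff ℝ 1 (fun z => f z * g z) := by
    rw [contDiff_iff_contDiffAt]
    intro z
    by_cases hz : z ∈ tsupport f
    · have : ContDiffAt ℂ 1 g z :=
        (hg.contDiffOn hU).contDiffAt (hU.mem_nhds (hfU hz))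
      exact hf.contDiffAt.mul (this.restrict_scalars ℝ)
    · refine (contDiffAt_const (c := (0 : ℂ))).congr_of_eventuallyEq ?_
      filter_upwards [notMem_tsupport_iff_eventuallyEq.1 hz] with w hw
      simp [hw]
  rw [← integral_dbar_eq_zero hfg hc.mul_right]
  congr 1
  ext z
  by_cases hz : z ∈ tsupport f
  · rw [dbar_mul_of_differentiableAt (hf.differentiable one_ne_zero z)
      (hg.differentiableAt (hU.mem_nhds (hfU hz)))]
  · rw [dbar_eq_zero_of_notMem_tsupport hz, zero_mul, dbar_eq_zero_of_notMem_tsupport]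
    exact fun h => hz (closure_mono (Function.support_mul_subset_left f g) h)

/-- A smooth function on the line, equal to `1` before `1` and to `0` after `2`. -/
noncomputable def lineCutoff (s : ℝ) : ℝ := Real.smoothTransition (2 - s)

theorem lineCutoff_of_le {s : ℝ} (h : s ≤ 1) : lineCutoff s = 1 :=
  Real.smoothTransition.one_of_one_le (by linarith)

theorem lineCutoff_of_ge {s : ℝ} (h : 2 ≤ s) : lineCutoff s = 0 :=
  Real.smoothTransition.zero_of_nonpos (by linarith)

theorem contDiff_lineCutoff : ContDiff ℝ 1 lineCutoff :=
  Real.smoothTransition.contDiff.comp (contDiff_const.sub contDiff_id)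

/-- A radial smooth bump around `a`. -/
noncomputable def radialBump (a z : ℂ) : ℂ := (lineCutoff (‖z - a‖ ^ 2) : ℂ)

theorem contDiff_radialBump (a : ℂ) : ContDiff ℝ 1 (radialBump a) :=
  Complex.ofRealCLM.contDiff.comp
    (contDiff_lineCutoff.comp ((contDiff_id.sub contDiff_const).norm_sq ℝ))

theorem hasCompactSupport_radialBump (a : ℂ) : HasCompactSupport (radialBump a) := by
  refine HasCompactSupport.of_support_subset_isCompact (isCompact_closedBall a 2) fun z hz => ?_
  by_contra h
  apply hz
  rw [Metric.mem_closedBall, dist_eq_norm] at h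
  rw [radialBump, lineCutoff_of_ge (by nlinarith), Complex.ofReal_zero]

theorem radialBump_eventually (a : ℂ) : ∀ᶠ z in nhds a, radialBump a z = 1 := by
  filter_upwards [Metric.ball_mem_nhds a one_pos] with z hz
  rw [mem_ball_iff_norm] at hz
  rw [radialBump, lineCutoff_of_le (by nlinarith [norm_nonneg (z - a)]), Complex.ofReal_one]

/-- Since `∂̄|z - a|² = 2(z - a)`, the chain rule yields a factor that cancels the Cauchy kernel. -/
theorem dbar_radialBump (a z : ℂ) :
    dbar (radialBump a) z = 2 * ((deriv lineCutoff (‖z - a‖ ^ 2) : ℝ) : ℂ) * (z - a) := by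
  have h1 : HasFDerivAt (fun w : ℂ => ‖w - a‖ ^ 2) _ z :=
    (((hasFDerivAt_id (𝕜 := ℝ) z).sub_const a).norm_sq)
  have h2 : HasDerivAt lineCutoff (deriv lineCutoff (‖z - a‖ ^ 2)) (‖z - a‖ ^ 2) :=
    (contDiff_lineCutoff.differentiable one_ne_zero _).hasDerivAt
  have h3 := (Complex.ofRealCLM.hasFDerivAt.comp z (h2.comp_hasFDerivAt z h1))
  have h4 : fderiv ℝ (radialBump a) z = _ := h3.fderiv
  unfold dbar
  rw [h4]
  apply Complex.ext <;> simp [Complex.inner] <;> ring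

theorem integral_deriv_lineCutoff :
    ∫ w : ℂ, deriv lineCutoff (‖w‖ ^ 2) = -Real.pi := by
  rw [MeasureTheory.integral_fun_norm_addHaar MeasureTheory.volume
    (fun y : ℝ => deriv lineCutoff (y ^ 2))]
  have hd (y : ℝ) : HasDerivAt (fun y : ℝ => lineCutoff (y ^ 2))
      (deriv lineCutoff (y ^ 2) * (2 * y)) y := by
    have h2 : HasDerivAt lineCutoff (deriv lineCutoff (y ^ 2)) (y ^ 2) :=
      (contDiff_lineCutoff.differentiable one_ne_zero _).hasDerivAt
    have h3 := HasDerivAt.comp (h := fun y : ℝ => y ^ 2) y h2 (hasDerivAt_pow 2 y)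
    norm_num at h3
    exact h3
  have hcs : HasCompactSupport (fun y : ℝ => lineCutoff (y ^ 2)) := by
    refine HasCompactSupport.of_support_subset_isCompact (isCompact_closedBall 0 2) fun z hz => ?_
    by_contra h
    apply hz
    rw [Metric.mem_closedBall, dist_eq_norm, sub_zero, Real.norm_eq_abs] at h
    exact lineCutoff_of_ge (by nlinarith [sq_abs z])
  have : ∫ y in Set.Ioi (0 : ℝ), deriv (fun y : ℝ => lineCutoff (y ^ 2)) y = -lineCutoff (0 ^ 2) :=
    hcs.integral_Ioi_deriv_eq (contDiff_lineCutoff.comp (contDiff_id.pow 2)) 0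
  have h2 : ∫ y in Set.Ioi (0 : ℝ), deriv lineCutoff (y ^ 2) * (2 * y) = -1 := by
    rw [← show -lineCutoff (0 ^ 2) = -1 by rw [lineCutoff_of_le (by norm_num)], ← this]
    exact MeasureTheory.integral_congr_ae (.of_forall fun y => (hd y).deriv.symm)
  have h3 : ∫ y in Set.Ioi (0 : ℝ), y * deriv lineCutoff (y ^ 2) = -1 / 2 := by
    rw [← h2, ← MeasureTheory.integral_div]
    congr 1; ext y; ring
  simp [Complex.finrank_real_complex, MeasureTheory.measureReal_def, h3]
  ring

theorem integral_dbar_radialBump (a : ℂ) :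
    ∫ z, dbar (radialBump a) z * (z - a)⁻¹ = -(2 * Real.pi) := by
  have h : ∀ᵐ z : ℂ, dbar (radialBump a) z * (z - a)⁻¹ =
      2 * ((deriv lineCutoff (‖z - a‖ ^ 2) : ℝ) : ℂ) := by
    have : ∀ᵐ z : ℂ, z ≠ a := by simp [MeasureTheory.ae_iff]
    filter_upwards [this] with z hz
    have := sub_ne_zero.2 hz
    rw [dbar_radialBump]; field_simp
  rw [MeasureTheory.integral_congr_ae h, MeasureTheory.integral_const_mul,
    integral_complex_ofReal,
    MeasureTheory.integral_sub_right_eq_self (fun w : ℂ => deriv lineCutoff (‖w‖ ^ 2)) a,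
    integral_deriv_lineCutoff]
  push_cast; ring

/-- The Cauchy-Pompeiu formula at a point near which the function is constant. -/

theorem integral_dbar_mul_inv_sub {f : ℂ → ℂ} {a : ℂ} (hf : ContDiff ℝ 1 f)
    (hc : HasCompactSupport f) (ha : ∀ᶠ z in nhds a, f z = 1) :
    ∫ z, dbar f z * (z - a)⁻¹ = -(2 * Real.pi) := by
  have hb := contDiff_radialBump a
  have hbc := hasCompactSupport_radialBump a
  -- The difference vanishes near `a`, so the kernel is holomorphic near its support; this reduces
  -- the claim to the radial bump.
  have hz := integral_dbar_mul_eq_zero (f := fun z => f z - radialBump a z)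
    (g := fun z => (z - a)⁻¹) (U := {a}ᶜ) isOpen_compl_singleton (hf.sub hb)
    (hc.sub hbc) ?_ ?_
  · have hi (g : ℂ → ℂ) (hg : ContDiff ℝ 1 g) (hgc : HasCompactSupport g)
        (hga : ∀ᶠ z in nhds a, g z = 1) :
        MeasureTheory.Integrable (fun z => dbar g z * (z - a)⁻¹) := by
      refine Continuous.integrable_of_hasCompactSupport ?_ hgc.dbar.mul_right
      rw [continuous_iff_continuousAt]
      intro z
      rcases eq_or_ne z a with rfl | h
      · refine (continuousAt_const (y := (0 : ℂ))).congr ?_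
        filter_upwards [hga.eventually_nhds] with w hw
        rw [dbar_eq_zero_of_eventuallyEq_const hw, zero_mul]
      · exact hg.continuous_dbar.continuousAt.mul
          ((continuousAt_id.sub continuousAt_const).inv₀ (sub_ne_zero.2 h))
    rw [← integral_dbar_radialBump a, ← sub_eq_zero, ← MeasureTheory.integral_sub (hi f hf hc ha)
      (hi _ hb hbc (radialBump_eventually a)), ← hz]
    congr 1; ext z
    rw [dbar_sub (hf.differentiable one_ne_zero z) (hb.differentiable one_ne_zero z)]
    ring
  · intro z hz
    rintro rfl
    refine notMem_tsupport_iff_eventuallyEq.2 ?_ hz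
    filter_upwards [ha, radialBump_eventually z] with w h1 h2
    simp [h1, h2]
  · intro z hz
    exact ((differentiableAt_id.sub_const a).inv (sub_ne_zero.2 hz)).differentiableWithinAt

/-! ### Weakly dense orbits and growth -/

section
variable {X : Type*} [NormedAddCommGroup X] [NormedSpace ℂ X]

theorem IsWeaklyHypercyclicVector.exists_pow_mem {T : X →L[ℂ] X} {x : X}
    (hx : IsWeaklyHypercyclicVector T x) {ι : Type*} (f : ι → X →L[ℂ] ℂ) {U : Set (ι → ℂ)}
    (hU : IsOpen U) {y : X} (hy : (fun i => f i y) ∈ U) :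
    ∃ n : ℕ, (fun i => f i ((T ^ n) x)) ∈ U := by
  have hc : Continuous fun w : WeakSpace ℂ X => fun i => f i ((toWeakSpace ℂ X).symm w) :=
    continuous_pi fun i => WeakBilin.eval_continuous (topDualPairing ℂ X).flip (f i)
  obtain ⟨w, hw, hw'⟩ := hx.inter_open_nonempty _ (hU.preimage hc)
    ⟨toWeakSpace ℂ X y, by simpa using hy⟩
  obtain ⟨_, ⟨n, rfl⟩, rfl⟩ := hw'
  exact ⟨n, by simpa using hw⟩

theorem IsWeaklyHypercyclicVector.not_bounded {T : X →L[ℂ] X} {x : X}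
    (hx : IsWeaklyHypercyclicVector T x) {f : X →L[ℂ] ℂ} (hf : f ≠ 0) (C : ℝ) :
    ∃ n : ℕ, C < ‖f ((T ^ n) x)‖ := by
  obtain ⟨y, hy⟩ : ∃ y, f y ≠ 0 := by
    by_contra! h
    exact hf (ContinuousLinearMap.ext h)
  exact hx.exists_pow_mem (ι := Unit) (fun _ => f) (U := {u | C < ‖u ()‖})
    (isOpen_lt continuous_const (continuous_apply ()).norm) (y := (((|C| + 1 : ℝ) : ℂ) / f y) • y)
    (by
      have : (0 : ℝ) ≤ |C| + 1 := by positivity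
      simp only [Set.mem_ofPred_eq, map_smul, smul_eq_mul, div_mul_cancel₀ _ hy,
        Complex.norm_real, Real.norm_eq_abs, abs_of_nonneg this]
      linarith [le_abs_self C])

/-- An exponentially growing sequence is bounded away from zero by a single functional. -/

theorem exists_dual_norm_ge_of_four_pow_le {y : ℕ → X} {c : ℝ}
    (hy : ∀ k, c * 4 ^ k ≤ ‖y k‖) :
    ∃ f : X →L[ℂ] ℂ, ∀ k, c / 6 ≤ ‖f (y k)‖ := by
  choose g hg1 hg2 using fun k => exists_dual_vector'' ℂ (y k)
  -- If `s` is small at `y k`, adding `4⁻ᵏ` times a norming functional makes it large there.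
  have hstep (k : ℕ) (s : X →L[ℂ] ℂ) : ∃ b : X →L[ℂ] ℂ, ‖b‖ ≤ (1 / 4 : ℝ) ^ k ∧
      (1 / 4 : ℝ) ^ k * ‖y k‖ / 2 ≤ ‖(s + b) (y k)‖ := by
    by_cases h : (1 / 4 : ℝ) ^ k * ‖y k‖ / 2 ≤ ‖s (y k)‖
    · exact ⟨0, by simp, by simpa using h⟩
    · refine ⟨((1 / 4 : ℝ) ^ k : ℂ) • g k, ?_, ?_⟩
      · rw [norm_smul]
        have : ‖((1 / 4 : ℝ) ^ k : ℂ)‖ = (1 / 4 : ℝ) ^ k := by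
          rw [norm_pow, Complex.norm_real]; norm_num
        rw [this]
        exact mul_le_of_le_one_right (by positivity) (hg1 k)
      · have h1 : ‖(((1 / 4 : ℝ) ^ k : ℂ) • g k) (y k)‖ = (1 / 4 : ℝ) ^ k * ‖y k‖ := by
          rw [smul_apply, hg2, norm_smul, norm_pow, Complex.norm_real]
          norm_num
        have h2 := norm_sub_le ((s + ((1 / 4 : ℝ) ^ k : ℂ) • g k) (y k)) (s (y k))
        rw [add_apply, add_sub_cancel_left, h1] at h2
        rw [add_apply]
        linarith
  choose b hb1 hb2 using hstep
  let s : ℕ → X →L[ℂ] ℂ := fun n => Nat.rec 0 (fun k s => s + b k s) n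
  have hs (k : ℕ) : s (k + 1) = s k + b k (s k) := rfl
  have hd (k : ℕ) : dist (s k) (s (k + 1)) ≤ 1 * (1 / 4 : ℝ) ^ k := by
    rw [dist_eq_norm', hs, add_sub_cancel_left, one_mul]
    exact hb1 k _
  obtain ⟨f, hf⟩ := cauchySeq_tendsto_of_complete
    (cauchySeq_of_le_geometric (1 / 4) 1 (by norm_num) hd)
  refine ⟨f, fun k => ?_⟩
  -- Later corrections total at most `4⁻ᵏ / 3`, leaving `1/2 - 1/3 = 1/6`.
  have h1 := dist_le_of_le_geometric_of_tendsto (1 / 4) 1 (by norm_num) hd hf (k + 1)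
  have h2 := hb2 k (s k)
  rw [← hs] at h2
  have h3 : ‖(s (k + 1) - f) (y k)‖ ≤ 1 * (1 / 4) ^ (k + 1) / (1 - 1 / 4) * ‖y k‖ :=
    (ContinuousLinearMap.le_opNorm _ _).trans
      (mul_le_mul_of_nonneg_right (by rwa [← dist_eq_norm]) (norm_nonneg _))
  have h4 := norm_sub_norm_le (s (k + 1) (y k)) (f (y k))
  rw [sub_apply] at h3
  have h5 : c ≤ (1 / 4 : ℝ) ^ k * ‖y k‖ := by
    have := mul_le_mul_of_nonneg_left (hy k) (show (0 : ℝ) ≤ (1 / 4) ^ k by positivity)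
    refine le_trans (le_of_eq ?_) this
    rw [mul_left_comm, ← mul_pow]; norm_num
  have h6 : 1 * (1 / 4) ^ (k + 1) / (1 - 1 / 4) * ‖y k‖ = (1 / 4 : ℝ) ^ k * ‖y k‖ / 3 := by
    rw [pow_succ]; ring
  rw [h6] at h3
  linarith

/-- With `r ^ m > 4`, each residue class of exponents mod `m` grows like `4 ^ k` and has its own
functional; together these `m` functionals separate the orbit from `0` weakly. -/
theorem IsWeaklyHypercyclicVector.not_geometric_growth {T : X →L[ℂ] X} {x : X}
    (hx : IsWeaklyHypercyclicVector T x) {c r : ℝ} (hc : 0 < c) (hr : 1 < r)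
    (h : ∀ n : ℕ, c * r ^ n ≤ ‖(T ^ n) x‖) : False := by
  obtain ⟨m, hm⟩ := pow_unbounded_of_one_lt 4 hr
  have hm0 : 0 < m := by
    rcases Nat.eq_zero_or_pos m with rfl | h
    · norm_num at hm
    · exact h
  have key (i : Fin m) : ∃ f : X →L[ℂ] ℂ, ∀ k, c / 6 ≤ ‖f ((T ^ (m * k + i)) x)‖ := by
    refine exists_dual_norm_ge_of_four_pow_le fun k => le_trans ?_ (h _)
    refine mul_le_mul_of_nonneg_left ?_ hc.le
    calc (4 : ℝ) ^ k ≤ (r ^ m) ^ k := pow_le_pow_left₀ (by norm_num) hm.le k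
      _ = r ^ (m * k) := (pow_mul r m k).symm
      _ ≤ _ := pow_le_pow_right₀ hr.le (Nat.le_add_right _ _)
  choose f hf using key
  obtain ⟨n, hn⟩ := hx.exists_pow_mem f (U := {u | ∀ i, ‖u i‖ < c / 6})
    (by
      simp only [Set.ofPred_forall]
      exact isOpen_iInter_of_finite fun i =>
        isOpen_lt (continuous_apply i).norm continuous_const) (y := 0)
    (by simp; intro _; positivity)
  have h1 := hn ⟨n % m, Nat.mod_lt _ hm0⟩
  have h2 := hf ⟨n % m, Nat.mod_lt _ hm0⟩ (n / m)
  rw [show m * (n / m) + n % m = n from Nat.div_add_mod n m] at h2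
  exact absurd h1 (not_lt.2 h2)

end

/-! ### Resolvent integrals over the plane -/

section
variable {A : Type*} [NormedRing A] [NormedAlgebra ℂ A]

/-- The integral over the plane of the resolvent of `a` against a scalar density. -/
noncomputable def resolventIntegral (a : A) (f : ℂ → ℂ) : A :=
  ∫ z, f z • resolvent a z

theorem commute_resolvent (a : A) (z : ℂ) : Commute a (resolvent a z) := by
  have h : Commute a (algebraMap ℂ A z - a) :=
    Commute.sub_right (Algebra.commutes z a).symm (Commute.refl a)
  unfold resolvent
  by_cases hu : IsUnit (algebraMap ℂ A z - a)
  · obtain ⟨u, hu⟩ := hu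
    rw [← hu] at h ⊢
    rw [Ring.inverse_unit]
    exact h.units_inv_right
  · rw [Ring.inverse_non_unit _ hu]
    exact Commute.zero_right a

theorem resolvent_mul_self {a : A} {z : ℂ} (hz : z ∈ resolventSet ℂ a) :
    resolvent a z * a = z • resolvent a z - 1 := by
  have h : resolvent a z * (algebraMap ℂ A z - a) = 1 := Ring.inverse_mul_cancel _ hz
  rw [mul_sub, ← Algebra.commutes, ← Algebra.smul_def] at h
  rw [← h]; abel

variable [CompleteSpace A]

theorem integrable_smul_resolvent {a : A} {f : ℂ → ℂ} (hf : Continuous f)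
    (hc : HasCompactSupport f) (hfa : tsupport f ⊆ resolventSet ℂ a) :
    MeasureTheory.Integrable fun z => f z • resolvent a z := by
  refine Continuous.integrable_of_hasCompactSupport (continuous_of_tsupport fun z hz => ?_)
    hc.smul_right
  have hz : z ∈ tsupport f := closure_mono (Function.support_smul_subset_left f _) hz
  exact hf.continuousAt.smul
    (spectrum.hasDerivAt_resolvent_const_left (hfa hz)).continuousAt

theorem commute_resolventIntegral {a : A} {f : ℂ → ℂ} (hf : Continuous f)
    (hc : HasCompactSupport f) (hfa : tsupport f ⊆ resolventSet ℂ a) :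
    Commute a (resolventIntegral a f) := by
  have hi := integrable_smul_resolvent hf hc hfa
  refine ((ContinuousLinearMap.mul ℂ A a).integral_comp_comm hi).symm.trans
    (Eq.trans ?_ (((ContinuousLinearMap.mul ℂ A).flip a).integral_comp_comm hi))
  congr 1; ext z
  exact (commute_resolvent a z).smul_right _

theorem resolventIntegral_mul_self {a : A} {f : ℂ → ℂ} (hf : Continuous f)
    (hc : HasCompactSupport f) (hfa : tsupport f ⊆ resolventSet ℂ a) :
    resolventIntegral a f * a =
      resolventIntegral a (fun z => f z * z) - (∫ z, f z) • (1 : A) := by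
  have hi := integrable_smul_resolvent hf hc hfa
  have hi' := integrable_smul_resolvent (f := fun z => f z * z) (a := a) (by fun_prop) hc.mul_right
    ((closure_mono (Function.support_mul_subset_left f _)).trans hfa)
  have hm : (∫ z, f z • resolvent a z) * a = ∫ z, (f z • resolvent a z) * a :=
    (((ContinuousLinearMap.mul ℂ A).flip a).integral_comp_comm hi).symm
  rw [resolventIntegral, resolventIntegral, hm,
    ← integral_smul_const, ← MeasureTheory.integral_sub hi'
      ((hf.integrable_of_hasCompactSupport hc).smul_const _)]
  congr 1; ext z
  by_cases hz : f z = 0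
  · simp [hz]
  · rw [smul_mul_assoc, resolvent_mul_self (hfa (subset_tsupport f hz)), smul_sub, mul_smul]

theorem continuous_dbar_mul {f u : ℂ → ℂ} (hf : ContDiff ℝ 1 f)
    (hu : ∀ z ∈ tsupport (dbar f), ContinuousAt u z) : Continuous fun z => dbar f z * u z :=
  continuous_of_tsupport fun z hz => hf.continuous_dbar.continuousAt.mul
    (hu z (closure_mono (Function.support_mul_subset_left (dbar f) u) hz))

theorem tsupport_dbar_mul_subset (f u : ℂ → ℂ) :
    tsupport (fun z => dbar f z * u z) ⊆ tsupport (dbar f) :=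
  closure_mono (Function.support_mul_subset_left (dbar f) u)

/-- The scalar error `∫ ∂̄f·u` vanishes by Stokes. -/
theorem resolventIntegral_dbar_mul_mul_self {a : A} {f u : ℂ → ℂ} {U : Set ℂ} (hU : IsOpen U)
    (hf : ContDiff ℝ 1 f) (hc : HasCompactSupport f) (hfU : tsupport f ⊆ U)
    (hfa : tsupport (dbar f) ⊆ resolventSet ℂ a) (hu : DifferentiableOn ℂ u U) :
    resolventIntegral a (fun z => dbar f z * u z) * a =
      resolventIntegral a (fun z => dbar f z * (u z * z)) := by
  rw [resolventIntegral_mul_self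
    (continuous_dbar_mul hf fun z hz =>
      (hu.differentiableAt (hU.mem_nhds (hfU (tsupport_dbar_subset f hz)))).continuousAt)
    hc.dbar.mul_right ((tsupport_dbar_mul_subset f u).trans hfa),
    integral_dbar_mul_eq_zero hU hf hc hfU hu, zero_smul, sub_zero]
  simp only [mul_assoc]

theorem norm_resolventIntegral_dbar_mul_le {a : A} {f u : ℂ → ℂ} {M : ℝ} (hf : ContDiff ℝ 1 f)
    (hc : HasCompactSupport f) (hfa : tsupport (dbar f) ⊆ resolventSet ℂ a)
    (hu : ∀ z ∈ tsupport f, ‖u z‖ ≤ M) :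
    ‖resolventIntegral a (fun z => dbar f z * u z)‖ ≤ M * ∫ z, ‖dbar f z • resolvent a z‖ := by
  rw [← MeasureTheory.integral_const_mul]
  refine MeasureTheory.norm_integral_le_of_norm_le
    ((integrable_smul_resolvent hf.continuous_dbar hc.dbar hfa).norm.const_mul M)
    (.of_forall fun z => ?_)
  by_cases hz : z ∈ tsupport f
  · beta_reduce
    rw [mul_comm (dbar f z), mul_smul, norm_smul]
    exact mul_le_mul_of_nonneg_right (hu z hz) (norm_nonneg _)
  · simp [dbar_eq_zero_of_notMem_tsupport hz]

/-- Were it zero, the integral `S` with density `∂̄f(z)/(z - c)` would satisfy `S (c - a) = -2π` by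
Cauchy-Pompeiu, making `c - a` invertible. -/
theorem resolventIntegral_dbar_ne_zero {a : A} {f : ℂ → ℂ} {c : ℂ} (hf : ContDiff ℝ 1 f)
    (hc : HasCompactSupport f) (hfa : tsupport (dbar f) ⊆ resolventSet ℂ a)
    (hcs : c ∈ spectrum ℂ a) (h1 : ∀ᶠ z in nhds c, f z = 1) :
    resolventIntegral a (dbar f) ≠ 0 := by
  intro h0
  let g : ℂ → ℂ := fun z => dbar f z * (z - c)⁻¹
  have hg : Continuous g := continuous_dbar_mul hf fun z hz => by
    refine (continuousAt_id.sub continuousAt_const).inv₀ (sub_ne_zero.2 ?_)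
    rintro rfl
    exact hcs (hfa hz)
  have hgc : HasCompactSupport g := hc.dbar.mul_right
  have hga : tsupport g ⊆ resolventSet ℂ a := (tsupport_dbar_mul_subset f _).trans hfa
  have h2 := resolventIntegral_mul_self hg hgc hga
  have h3 : resolventIntegral a (fun z => g z * z) = c • resolventIntegral a g := by
    rw [← sub_eq_zero, ← h0, resolventIntegral, resolventIntegral, resolventIntegral,
      ← MeasureTheory.integral_smul, ← MeasureTheory.integral_sub]
    · congr 1; ext z
      rw [smul_smul, ← sub_smul]
      congr 1
      rcases eq_or_ne z c with rfl | hz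
      · simp [dbar_eq_zero_of_eventuallyEq_const h1, g]
      · have := sub_ne_zero.2 hz
        simp only [g]; field_simp
    · exact integrable_smul_resolvent (by fun_prop) hgc.mul_right
        ((closure_mono (Function.support_mul_subset_left g _)).trans hga)
    · exact (integrable_smul_resolvent hg hgc hga).smul c
  have h4 : resolventIntegral a g * (algebraMap ℂ A c - a) = (-(2 * Real.pi) : ℂ) • (1 : A) := by
    rw [mul_sub, h2, h3, integral_dbar_mul_inv_sub hf hc h1, ← Algebra.commutes, ← Algebra.smul_def]
    abel
  have hpi : (-(2 * Real.pi) : ℂ) ≠ 0 := by simp [Real.pi_ne_zero]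
  have hcomm : Commute (algebraMap ℂ A c - a) (resolventIntegral a g) :=
    Commute.sub_left (Algebra.commutes c _) (commute_resolventIntegral hg hgc hga)
  apply hcs
  refine ⟨⟨algebraMap ℂ A c - a, (-(2 * Real.pi) : ℂ)⁻¹ • resolventIntegral a g, ?_, ?_⟩, rfl⟩
  · rw [mul_smul_comm, hcomm.eq, h4, smul_smul, inv_mul_cancel₀ hpi, one_smul]
  · rw [smul_mul_assoc, h4, smul_smul, inv_mul_cancel₀ hpi, one_smul]

end

/-! ### Isolating a component of the spectrum -/

/-- A compact subset of an open set has a smooth cutoff function. -/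

theorem exists_contDiff_cutoff {K V : Set ℂ} (hK : IsCompact K) (hV : IsOpen V) (hKV : K ⊆ V) :
    ∃ f : ℂ → ℂ, ContDiff ℝ 1 f ∧ HasCompactSupport f ∧ tsupport f ⊆ V ∧
      ∀ z ∈ K, ∀ᶠ w in nhds z, f w = 1 := by
  obtain ⟨L, hL, hKL, hLV⟩ := exists_compact_between hK hV hKV
  obtain ⟨f, hf1, hf0, -⟩ := exists_contMDiffMap_one_nhds_of_subset_interior
    (modelWithCornersSelf ℝ ℂ) (n := 1) hK.isClosed hKL
  have hs : Function.support (fun z => (f z : ℂ)) ⊆ L := fun z hz => by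
    by_contra h
    exact hz (by simp [hf0 z h])
  refine ⟨fun z => (f z : ℂ), Complex.ofRealCLM.contDiff.comp f.contMDiff.contDiff,
    .of_support_subset_isCompact hL hs, (closure_minimal hs hL.isClosed).trans hLV, fun z hz => ?_⟩
  filter_upwards [Filter.Eventually.filter_mono (nhds_le_nhdsSet hz) hf1] with w hw
  simp [hw]

/-- A neighbourhood of a component of a compact set contains a clopen piece around it. -/

theorem IsCompact.exists_clopen_piece {α : Type*} [TopologicalSpace α] [T2Space α] {S V : Set α}
    (hS : IsCompact S) (hV : IsOpen V) {z : α} (hz : z ∈ S) (h : connectedComponentIn S z ⊆ V) :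
    ∃ K L : Set α, IsCompact K ∧ IsCompact L ∧ K ∪ L = S ∧ Disjoint K L ∧ z ∈ K ∧ K ⊆ V := by
  have : CompactSpace S := isCompact_iff_compactSpace.1 hS
  rw [connectedComponentIn_eq_image hz, connectedComponent_eq_iInter_isClopen] at h
  have : Nonempty {s : Set S // IsClopen s ∧ (⟨z, hz⟩ : S) ∈ s} := ⟨⟨Set.univ, isClopen_univ, trivial⟩⟩
  -- The component is a directed intersection of clopen sets, so by compactness one of them already
  -- lies in `V`.
  obtain ⟨⟨s, hs, hzs⟩, hsV⟩ := exists_subset_nhds_of_compactSpace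
    (V := fun s : {s : Set S // IsClopen s ∧ (⟨z, hz⟩ : S) ∈ s} => (s : Set S))
    (fun s t => ⟨⟨s ∩ t, s.2.1.inter t.2.1, s.2.2, t.2.2⟩, Set.inter_subset_left,
      Set.inter_subset_right⟩) (fun s => s.2.1.1) (U := Subtype.val ⁻¹' V)
    (fun x hx => (hV.preimage continuous_subtype_val).mem_nhds (h ⟨x, hx, rfl⟩))
  refine ⟨Subtype.val '' s, Subtype.val '' sᶜ, hs.1.isCompact.image continuous_subtype_val,
    hs.compl.1.isCompact.image continuous_subtype_val, ?_, ?_, ⟨_, hzs, rfl⟩,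
    Set.image_subset_iff.2 hsV⟩
  · rw [← Set.image_union, Set.union_compl_self, Set.image_univ, Subtype.range_coe]
  · exact (Set.disjoint_image_iff Subtype.val_injective).2 disjoint_compl_right

/-- A cutoff function around a component of the spectrum, with `∂̄` supported off the spectrum. -/

theorem exists_spectral_cutoff {A : Type*} [NormedRing A] [NormedAlgebra ℂ A] [CompleteSpace A]
    {a : A} {V : Set ℂ} (hV : IsOpen V) {z : ℂ} (hz : z ∈ spectrum ℂ a)
    (h : connectedComponentIn (spectrum ℂ a) z ⊆ V) :
    ∃ f : ℂ → ℂ, ContDiff ℝ 1 f ∧ HasCompactSupport f ∧ tsupport f ⊆ V ∧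
      (∀ᶠ w in nhds z, f w = 1) ∧ tsupport (dbar f) ⊆ resolventSet ℂ a := by
  obtain ⟨K, L, hK, hL, hKL, hd, hzK, hKV⟩ := (spectrum.isCompact a).exists_clopen_piece hV hz h
  -- Being `1` near `K` and supported off `L`, `f` is locally constant near the whole spectrum.
  obtain ⟨f, hf, hfc, hfV, hf1⟩ := exists_contDiff_cutoff hK (hV.sdiff hL.isClosed)
    (Set.subset_sdiff.2 ⟨hKV, hd⟩)
  refine ⟨f, hf, hfc, hfV.trans Set.sdiff_subset, hf1 z hzK, fun w hw => ?_⟩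
  by_contra hws
  have hws : w ∈ K ∪ L := by rw [hKL]; exact hws
  rcases hws with hwK | hwL
  · refine notMem_tsupport_iff_eventuallyEq.2 ?_ hw
    filter_upwards [(hf1 w hwK).eventually_nhds] with v hv
    exact dbar_eq_zero_of_eventuallyEq_const hv
  · exact (hfV (tsupport_dbar_subset f hw)).2 hwL

/-! ### Components inside and outside the circle -/

theorem IsWeaklyHypercyclicVector.not_connectedComponentIn_subset_ball {X : Type*}
    [NormedAddCommGroup X] [NormedSpace ℂ X] [CompleteSpace X] {T : X →L[ℂ] X} {x : X}
    (hx : IsWeaklyHypercyclicVector T x) {z : ℂ} (hz : z ∈ spectrum ℂ T) :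
    ¬ connectedComponentIn (spectrum ℂ T) z ⊆ {w | ‖w‖ < 1} := by
  intro h
  obtain ⟨f, hf, hfc, hfV, hf1, hfa⟩ :=
    exists_spectral_cutoff (isOpen_lt continuous_norm continuous_const) hz h
  have hP0 := resolventIntegral_dbar_ne_zero hf hfc hfa hz hf1
  have hpow (n : ℕ) : resolventIntegral T (dbar f) * T ^ n =
      resolventIntegral T (fun w => dbar f w * w ^ n) := by
    induction n with
    | zero => simp
    | succ n ih =>
      rw [pow_succ, ← mul_assoc, ih, resolventIntegral_dbar_mul_mul_self (u := fun w => w ^ n)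
        isOpen_univ hf hfc (Set.subset_univ _) hfa (differentiable_pow n).differentiableOn]
      simp only [pow_succ]
  have hbd (n : ℕ) : ‖resolventIntegral T (dbar f) * T ^ n‖ ≤
      1 * ∫ w, ‖dbar f w • resolvent T w‖ := by
    rw [hpow]
    refine norm_resolventIntegral_dbar_mul_le hf hfc hfa fun w hw => ?_
    rw [norm_pow]
    exact pow_le_one₀ (norm_nonneg _) (hfV hw).le
  obtain ⟨y, hy⟩ : ∃ y, resolventIntegral T (dbar f) y ≠ 0 := by
    by_contra! h
    exact hP0 (ContinuousLinearMap.ext h)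
  obtain ⟨g, -, hg⟩ := exists_dual_vector ℂ _ (norm_ne_zero_iff.2 hy)
  have hg0 : g ∘L resolventIntegral T (dbar f) ≠ 0 := fun h0 => by
    have := congrArg (fun k : X →L[ℂ] ℂ => k y) h0
    simp only [ContinuousLinearMap.comp_apply, hg] at this
    exact hy (by simpa using this)
  obtain ⟨n, hn⟩ := hx.not_bounded hg0 (‖g‖ * ((1 * ∫ w, ‖dbar f w • resolvent T w‖) * ‖x‖))
  refine absurd hn (not_lt.2 ?_)
  exact (g.le_opNorm _).trans (mul_le_mul_of_nonneg_left
    (((resolventIntegral T (dbar f) * T ^ n).le_opNorm x).trans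
      (mul_le_mul_of_nonneg_right (hbd n) (norm_nonneg _))) (norm_nonneg _))

theorem IsWeaklyHypercyclicVector.not_connectedComponentIn_subset_exterior {X : Type*}
    [NormedAddCommGroup X] [NormedSpace ℂ X] [CompleteSpace X] {T : X →L[ℂ] X} {x : X}
    (hx : IsWeaklyHypercyclicVector T x) {z : ℂ} (hz : z ∈ spectrum ℂ T) :
    ¬ connectedComponentIn (spectrum ℂ T) z ⊆ {w | 1 < ‖w‖} := by
  intro h
  obtain ⟨f, hf, hfc, hfV, hf1, hfa⟩ :=
    exists_spectral_cutoff (isOpen_lt continuous_const continuous_norm) hz h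
  have hP0 := resolventIntegral_dbar_ne_zero hf hfc hfa hz hf1
  have hcomm := commute_resolventIntegral hf.continuous_dbar hfc.dbar hfa
  have hzf : z ∈ tsupport f := subset_tsupport f (by simp [hf1.self_of_nhds])
  -- The least modulus on the support of `f` is the growth rate.
  obtain ⟨w₀, hw₀, hmin⟩ := IsCompact.exists_isMinOn hfc ⟨z, hzf⟩ continuous_norm.continuousOn
  have hr : 1 < ‖w₀‖ := hfV hw₀
  have hne {w : ℂ} (hw : w ∈ tsupport f) : w ≠ 0 := by
    rintro rfl
    have : (1 : ℝ) < ‖(0 : ℂ)‖ := hfV hw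
    norm_num at this
  have hpow (n : ℕ) : resolventIntegral T (fun w => dbar f w * w⁻¹ ^ n) * T ^ n =
      resolventIntegral T (dbar f) := by
    induction n with
    | zero => simp
    | succ n ih =>
      rw [pow_succ', ← mul_assoc, resolventIntegral_dbar_mul_mul_self
        (u := fun w => w⁻¹ ^ (n + 1)) (isOpen_compl_singleton (x := (0 : ℂ))) hf hfc (fun w hw => hne hw) hfa
        (fun w hw => ((differentiableAt_inv hw).pow _).differentiableWithinAt), ← ih]
      congr 2
      ext w
      by_cases hw : w ∈ tsupport f
      · have := hne hw
        simp [pow_succ, this]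
      · simp [dbar_eq_zero_of_notMem_tsupport hw]
  set P := resolventIntegral T (dbar f)
  set C := ∫ w, ‖dbar f w • resolvent T w‖
  have hC0 : 0 ≤ C := MeasureTheory.integral_nonneg fun _ => norm_nonneg _
  have hgrowth (n : ℕ) : ‖P x‖ ≤ (‖w₀‖⁻¹ ^ n * C) * ‖(T ^ n) x‖ := by
    rw [← hpow n]
    refine ((resolventIntegral T (fun w => dbar f w * w⁻¹ ^ n)).le_opNorm _).trans
      (mul_le_mul_of_nonneg_right ?_ (norm_nonneg _))
    refine norm_resolventIntegral_dbar_mul_le hf hfc hfa fun w hw => ?_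
    rw [norm_pow, norm_inv]
    exact pow_le_pow_left₀ (by positivity) (inv_anti₀ (by positivity) (hmin hw)) n
  -- As `P` commutes with `T`, `P x = 0` would make `P` vanish on the whole orbit.
  have hPx : P x ≠ 0 := by
    intro h0
    obtain ⟨y, hy⟩ : ∃ y, P y ≠ 0 := by
      by_contra! h
      exact hP0 (ContinuousLinearMap.ext h)
    obtain ⟨g, -, hg⟩ := exists_dual_vector ℂ _ (norm_ne_zero_iff.2 hy)
    have hg0 : g ∘L P ≠ 0 := fun h0 => by
      have := congrArg (fun k : X →L[ℂ] ℂ => k y) h0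
      simp only [ContinuousLinearMap.comp_apply, hg] at this
      exact hy (by simpa using this)
    obtain ⟨n, hn⟩ := hx.not_bounded hg0 0
    have : P ((T ^ n) x) = (T ^ n) (P x) :=
      congrArg (fun k : X →L[ℂ] X => k x) (hcomm.pow_left n).eq.symm
    rw [ContinuousLinearMap.comp_apply, this, h0, map_zero, map_zero, norm_zero] at hn
    exact lt_irrefl _ hn
  -- `C + 1` replaces `C` to keep the denominator positive.
  refine hx.not_geometric_growth (c := ‖P x‖ / (C + 1))
    (div_pos (norm_pos_iff.2 hPx) (by positivity)) hr fun n => ?_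
  have hwn : 0 < ‖w₀‖ ^ n := by positivity
  rw [div_mul_eq_mul_div, div_le_iff₀ (by positivity)]
  have h1 := mul_le_mul_of_nonneg_right (hgrowth n) hwn.le
  have h2 : ‖w₀‖⁻¹ ^ n * C * ‖(T ^ n) x‖ * ‖w₀‖ ^ n = C * ‖(T ^ n) x‖ := by
    rw [inv_pow]; field_simp
  rw [h2] at h1
  nlinarith [norm_nonneg ((T ^ n) x)]

theorem mainTheorem1 {X : Type*} [NormedAddCommGroup X] [NormedSpace ℂ X] [CompleteSpace X]
    [Nontrivial X] (T : X →L[ℂ] X) (hT : IsWeaklyHypercyclic T) :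
    ∀ z ∈ spectrum ℂ T,
      (connectedComponentIn (spectrum ℂ T) z ∩ {w : ℂ | ‖w‖ = 1}).Nonempty := by
  intro z hz
  obtain ⟨x, hx⟩ := hT
  have hc : IsPreconnected (connectedComponentIn (spectrum ℂ T) z) :=
    isPreconnected_connectedComponentIn
  obtain ⟨w₁, hw₁, h₁⟩ := Set.not_subset.1 (hx.not_connectedComponentIn_subset_ball hz)
  obtain ⟨w₂, hw₂, h₂⟩ := Set.not_subset.1 (hx.not_connectedComponentIn_subset_exterior hz)
  obtain ⟨w, hw, hw1⟩ := hc.intermediate_value hw₂ hw₁ continuous_norm.continuousOn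
    ⟨not_lt.1 h₂, not_lt.1 h₁⟩
  exact ⟨w, hw, hw1⟩
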